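/- Let $(X,Y)$ be a pair of random elements on a finite joint alphabet $\{1,\dots,I\}\times\{1,\dots,J\}$ with joint distribution $p=(p_{i,j})$ and marginals $p_{i,\cdot}=\sum_j p_{i,j}$, $p_{\cdot,j}=\sum_i p_{i,j}$. Let $\lambda\in(0,1)\cup(1,\infty)$. For a vector $q=(q_k)$ of nonnegative numbers, not all zero, write $q_k^*=q_k^\lambda/\sum_s q_s^\lambda$ (power escort transformation) and, with the convention $0\ln 0=0$, put $$T_A(p)=\sum_{i,j}p_{i,j}^*\ln p_{i,j}^*-\sum_i (p_{i,\cdot})^*\ln (p_{i,\cdot})^*-\sum_j (p_{\cdot,j})^*\ln (p_{\cdot,j})^*,$$ where the escort transformation is applied to the joint distribution $(p_{i,j})_{i,j}$, to the marginal $(p_{i,\cdot})_i$ and to the marginal $(p_{\cdot,j})_j$, respectively. Let $\hat p_{i,j}=f_{i,j}/n$ be the relative frequencies in an i.i.d. sample of size $n$ from $p$, and let $\hat T_A=T_A(\hat p)$ be the plug-in estimator. Assume that $X$ and $Y$ are independent and that neither marginal distribution is uniform on its support (that is, each marginal takes at least two different positive values; if all letters have positive probability, this says that neither marginal is uniform).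 Then $$\sqrt n\,\hat T_A\xrightarrow{d}N(0,\sigma^2)\quad\text{as }n\to\infty,\qquad \sigma^2=\nabla^{\top}\Sigma\nabla>0.$$ Here one fixes any reference cell $r$ with $p_r>0$ and regards $T_A$ as a function of the $IJ-1$ coordinates $v=(p_{i,j})_{(i,j)\neq r}$, with $p_r=1-\sum_{(i,j)\ne r}p_{i,j}$; $\nabla$ is the vector of partial derivatives of $T_A$ with respect to these coordinates at the true distribution, and $\Sigma$ is the $(IJ-1)\times(IJ-1)$ multinomial covariance matrix with entries $\Sigma_{cc}=v_c(1-v_c)$ and $\Sigma_{cd}=-v_cv_d$ for $c\neq d$. The partial derivatives exist at all coordinates with $v_c>0$; coordinates with $v_c=0$ have zero rows and columns in $\Sigma$ and do not contribute (set the corresponding entries of $\nabla$ to $0$ where the derivative does not exist). -/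

import Mathlib

open MeasureTheory ProbabilityTheory Filter Topology Matrix

noncomputable section

namespace EscortMI

/-- Power escort transformation `q ↦ q*`, with `q*_k = q_k ^ lam / ∑ s, q_s ^ lam`. -/
def escort {κ : Type*} [Fintype κ] (lam : ℝ) (q : κ → ℝ) (k : κ) : ℝ :=
  q k ^ lam / ∑ s, q s ^ lam

/-- `∑ k, q_k ln q_k`, the negative of Shannon's entropy (with `0 ln 0 = 0`). -/
def sumMulLog {κ : Type*} [Fintype κ] (q : κ → ℝ) : ℝ :=
  ∑ k, q k * Real.log (q k)

/-- Row marginal `p_{i,·} = ∑ j, p_{i,j}`. -/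
def marginalX {α β : Type*} [Fintype β] (p : α × β → ℝ) (i : α) : ℝ :=
  ∑ j, p (i, j)

/-- Column marginal `p_{·,j} = ∑ i, p_{i,j}`. -/
def marginalY {α β : Type*} [Fintype α] (p : α × β → ℝ) (j : β) : ℝ :=
  ∑ i, p (i, j)

/-- The first bracketed term of the decomposition of the mutual information of the escort
distribution: the escort transformation is applied to the joint distribution in the first sum,
and to the two marginal distributions of `p` in the other two. -/
def TA {α β : Type*} [Fintype α] [Fintype β] (lam : ℝ) (p : α × β → ℝ) : ℝ :=
  sumMulLog (escort lam p) - sumMulLog (escort lam (marginalX p))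
    - sumMulLog (escort lam (marginalY p))

/-- All letters of positive probability have the same probability. For a distribution
without letters of probability zero this is uniformity. -/
def IsUniformOnSupport {κ : Type*} (q : κ → ℝ) : Prop :=
  ∀ a b, 0 < q a → 0 < q b → q a = q b

/-- The joint distribution `p_{i,j} = P(X = i, Y = j)`. -/
def jointProb {α β Ω : Type*} [MeasurableSpace Ω] (P : Measure Ω) (X : Ω → α) (Y : Ω → β)
    (c : α × β) : ℝ :=
  P.real {ω | X ω = c.1 ∧ Y ω = c.2}

/-- The empirical distribution `f_c / n` of the first `n` observations. -/
def empirical {κ Ω : Type*} [DecidableEq κ] (Z : ℕ → Ω → κ) (n : ℕ) (ω : Ω) (c : κ) : ℝ :=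
  (((Finset.range n).filter (fun k => Z k ω = c)).card : ℝ) / n

/-- The free coordinates of `p`: all the cells other than the reference cell `r`. -/
def freeCoord {κ : Type*} (r : κ) (p : κ → ℝ) (c : {c : κ // c ≠ r}) : ℝ := p c

/-- The vector on all cells with free coordinates `v` and total mass one. -/
def ofFree {κ : Type*} [Fintype κ] [DecidableEq κ] (r : κ) (v : {c : κ // c ≠ r} → ℝ)
    (c : κ) : ℝ :=
  if h : c = r then 1 - ∑ d, v d else v ⟨c, h⟩

/-- `TA` as a function of the `c`-th free coordinate, the other free coordinates being those
of `p` and the mass of the reference cell being one minus the sum of the free coordinates. -/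
def TASection {α β : Type*} [Fintype α] [Fintype β] [DecidableEq α] [DecidableEq β]
    (lam : ℝ) (r : α × β) (p : α × β → ℝ) (c : {c : α × β // c ≠ r}) (t : ℝ) : ℝ :=
  TA lam (ofFree r (Function.update (freeCoord r p) c t))

/-- The gradient of `TA` with respect to the free coordinates. -/
def gradTA {α β : Type*} [Fintype α] [Fintype β] [DecidableEq α] [DecidableEq β]
    (lam : ℝ) (r : α × β) (p : α × β → ℝ) (c : {c : α × β // c ≠ r}) : ℝ :=
  deriv (TASection lam r p c) (p c)

/-- The multinomial covariance matrix of the vector `v`. -/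
def multinomialCov {κ : Type*} [DecidableEq κ] (v : κ → ℝ) : Matrix κ κ ℝ :=
  Matrix.of fun c d => if c = d then v c * (1 - v c) else -(v c * v d)

/-- The asymptotic variance `∇ᵀ Σ ∇`. A cell of probability zero has a zero row and column in
`Σ`, so only the partial derivatives at cells of positive probability enter. -/
def asympVar {α β : Type*} [Fintype α] [Fintype β] [DecidableEq α] [DecidableEq β]
    (lam : ℝ) (r : α × β) (p : α × β → ℝ) : ℝ :=
  gradTA lam r p ⬝ᵥ (multinomialCov (freeCoord r p) *ᵥ gradTA lam r p)

end EscortMI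

end

noncomputable section

namespace EscortMI

/-! The proof is the delta method at `p = a ⊗ b`. The escort of a product is the product of the
escorts, so `T_A` vanishes at `p` (`TA_prod`), and what remains is to find its differential and show
that the linear part does not degenerate. Zero cells are an obstacle, since `x ^ lam` need not be
differentiable at `0`. The sample almost surely never visits them, so `TA` may be replaced by `TA ∘
restrictSupport p`, which is differentiable at `p` with gradient `g = cellGrad lam p`
(`hasFDerivAt_TA_restrictSupport`). The linear part of `√n T_A(p̂)` is then a normalised sum of the
iid variables `g (Z k)`. Chebyshev's inequality controls the remainder and the central limit theorem
gives the limit (`tendstoInDistribution_sqrt_mul_empirical`). Under independence `g (Z k)` has mean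
zero, so its variance is `∑ p g²`. This equals `∇ᵀΣ∇`, because `∇_c = g_c - g_r` on the support
(`asympVar_eq`). For positivity, let `w` be the density of the escort distribution with respect to
the original one and `x` the deviation of `ln q` from its escort mean. Then `g(i,j) = lam² (w_i x_i
(w_j - 1) + w_j x_j (w_i - 1))`. When `i` and `j` are modes of non-uniform marginals, both summands
are nonzero with the sign of `lam - 1`, so `g(i,j) ≠ 0`. -/

/-! ### Differentiating the escort entropy and `TA` on the support of `p`. -/

/-- The partial derivatives of `q ↦ sumMulLog (escort lam q)`. -/
def entropyGrad {κ : Type*} [Fintype κ] (lam : ℝ) (q : κ → ℝ) (k : κ) : ℝ :=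
  lam ^ 2 * (q k ^ (lam - 1) / ∑ s, q s ^ lam) *
    (Real.log (q k) - (∑ s, q s ^ lam * Real.log (q s)) / ∑ s, q s ^ lam)

lemma sum_rpow_pos {κ : Type*} [Fintype κ] {lam : ℝ} {q : κ → ℝ} (hq : ∀ k, 0 ≤ q k)
    (h : ∃ k, 0 < q k) : 0 < ∑ s, q s ^ lam := by
  obtain ⟨k, hk⟩ := h
  exact Finset.sum_pos' (fun s _ => Real.rpow_nonneg (hq s) _)
    ⟨k, Finset.mem_univ _, Real.rpow_pos_of_pos hk _⟩

lemma sumMulLog_escort {κ : Type*} [Fintype κ] {lam : ℝ} (hlam : lam ≠ 0) {q : κ → ℝ}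
    (hq : ∀ k, 0 ≤ q k) (h : ∃ k, 0 < q k) :
    sumMulLog (escort lam q) =
      lam * ((∑ s, q s ^ lam * Real.log (q s)) / ∑ s, q s ^ lam)
        - Real.log (∑ s, q s ^ lam) := by
  have hS := sum_rpow_pos (lam := lam) hq h
  have key : ∀ k, escort lam q k * Real.log (escort lam q k) =
      lam * (q k ^ lam * Real.log (q k)) / (∑ s, q s ^ lam)
        - q k ^ lam * (Real.log (∑ s, q s ^ lam) / ∑ s, q s ^ lam) := by
    intro k
    rcases (hq k).eq_or_lt with h0 | hk
    · simp [escort, ← h0, Real.zero_rpow hlam]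
    · rw [escort, Real.log_div (Real.rpow_pos_of_pos hk _).ne' hS.ne', Real.log_rpow hk]
      ring
  rw [sumMulLog, Finset.sum_congr rfl fun k _ => key k, Finset.sum_sub_distrib,
    ← Finset.sum_mul, ← Finset.sum_div, ← Finset.mul_sum, mul_div_cancel₀ _ hS.ne']
  ring

/-- The dichotomy on coordinates (positive, or identically zero with zero derivative) avoids
differentiating `x ^ lam` at `0`. The value of `entropyGrad` at a zero coordinate is irrelevant,
being multiplied by `q' k = 0`. A general `E` allows the same lemma to serve the joint distribution
and both marginals. -/
lemma hasFDerivAt_sumMulLog_escort {κ E : Type*} [Fintype κ] [NormedAddCommGroup E]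
    [NormedSpace ℝ E] {lam : ℝ} (hlam : lam ≠ 0) {q : E → κ → ℝ} {q' : κ → E →L[ℝ] ℝ} {x : E}
    (hq : ∀ k, (0 < q x k ∧ HasFDerivAt (fun y => q y k) (q' k) x) ∨
      ((∀ y, q y k = 0) ∧ q' k = 0)) (hpos : ∃ k, 0 < q x k) :
    HasFDerivAt (fun y => sumMulLog (escort lam (q y)))
      (∑ k, entropyGrad lam (q x) k • q' k) x := by
  have hev : ∀ᶠ y in 𝓝 x, ∀ k, (0 < q x k → 0 < q y k) ∧ 0 ≤ q y k := by
    refine eventually_all.2 fun k => ?_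
    rcases hq k with ⟨hk, hd⟩ | ⟨h0, -⟩
    · filter_upwards [hd.continuousAt.eventually (lt_mem_nhds hk)] with y hy
      exact ⟨fun _ => hy, hy.le⟩
    · exact Eventually.of_forall fun y => by simp [h0]
  have hx := hev.self_of_nhds
  have hS := sum_rpow_pos (lam := lam) (fun k => (hx k).2) hpos
  have hpow : ∀ k, HasFDerivAt (fun y => q y k ^ lam)
      ((lam * q x k ^ (lam - 1)) • q' k) x := by
    intro k
    rcases hq k with ⟨hk, hd⟩ | ⟨h0, h0'⟩
    · exact hd.rpow_const (Or.inl hk.ne')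
    · simpa [h0, h0'] using hasFDerivAt_const ((0 : ℝ) ^ lam) x
  have hlog : ∀ k, HasFDerivAt (fun y => q y k ^ lam * Real.log (q y k))
      ((lam * q x k ^ (lam - 1) * Real.log (q x k) + q x k ^ (lam - 1)) • q' k) x := by
    intro k
    rcases hq k with ⟨hk, hd⟩ | ⟨h0, h0'⟩
    · refine ((hpow k).mul (hd.log hk.ne')).congr_fderiv ?_
      ext v
      have : q x k ^ lam * (q x k)⁻¹ = q x k ^ (lam - 1) := by
        rw [Real.rpow_sub_one hk.ne', div_eq_mul_inv]
      simp only [_root_.add_apply, _root_.smul_apply, smul_eq_mul,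
        ← this]
      ring
    · simpa [h0, h0'] using hasFDerivAt_const (0 : ℝ) x
  have hSd := HasFDerivAt.fun_sum (u := Finset.univ) fun k _ => hpow k
  have hAd := HasFDerivAt.fun_sum (u := Finset.univ) fun k _ => hlog k
  have hmain := ((hAd.mul ((hasDerivAt_inv hS.ne').comp_hasFDerivAt x hSd)).const_mul lam).sub (hSd.log hS.ne')
  refine (hmain.congr_of_eventuallyEq ?_).congr_fderiv ?_
  · filter_upwards [hev] with y hy
    obtain ⟨k, hk⟩ := hpos
    rw [sumMulLog_escort hlam (fun k => (hy k).2) ⟨k, (hy k).1 hk⟩, div_eq_mul_inv]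
    rfl
  · ext v
    simp only [_root_.sub_apply, _root_.add_apply, _root_.smul_apply, _root_.sum_apply,
      smul_eq_mul, Function.comp_apply, entropyGrad]
    generalize (∑ s, q x s ^ lam) = S at hS
    generalize (∑ s, q x s ^ lam * Real.log (q x s)) = A
    simp only [Finset.mul_sum, ← Finset.sum_sub_distrib, ← Finset.sum_add_distrib]
    refine Finset.sum_congr rfl fun k _ => ?_
    field_simp
    ring

/-- The vector `q` with the cells outside the support of `p` set to zero. -/
def restrictSupport {κ : Type*} (p q : κ → ℝ) (c : κ) : ℝ := if 0 < p c then q c else 0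

lemma restrictSupport_eq_self {κ : Type*} {p q : κ → ℝ} (h : ∀ c, ¬ 0 < p c → q c = 0) :
    restrictSupport p q = q := by
  ext c
  unfold restrictSupport
  split_ifs with hc
  · rfl
  · exact (h c hc).symm

/-- The partial derivatives of `TA` at `p` in the cells of the support of `p`, the cells being
independent coordinates. -/
def cellGrad {α β : Type*} [Fintype α] [Fintype β] (lam : ℝ) (p : α × β → ℝ) (c : α × β) : ℝ :=
  if 0 < p c then entropyGrad lam p c - entropyGrad lam (marginalX p) c.1
    - entropyGrad lam (marginalY p) c.2 else 0

lemma hasFDerivAt_TA_restrictSupport {α β : Type*} [Fintype α] [Fintype β] {lam : ℝ}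
    (hlam : lam ≠ 0) {p : α × β → ℝ} (hp : ∀ c, 0 ≤ p c) (hpos : ∃ c, 0 < p c) :
    HasFDerivAt (fun q => TA lam (restrictSupport p q))
      (∑ c, cellGrad lam p c • ContinuousLinearMap.proj (R := ℝ) (φ := fun _ => ℝ) c) p := by
  have hpp : restrictSupport p p = p :=
    restrictSupport_eq_self fun c hc => le_antisymm (not_lt.1 hc) (hp c)
  set d : α × β → ((α × β → ℝ) →L[ℝ] ℝ) := fun c =>
    if 0 < p c then ContinuousLinearMap.proj (R := ℝ) (φ := fun _ => ℝ) c else 0 with hd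
  have hcell : ∀ c, HasFDerivAt (fun q => restrictSupport p q c) (d c) p := by
    intro c
    by_cases hc : 0 < p c
    · simpa only [restrictSupport, hd, hc, if_true] using hasFDerivAt_apply (𝕜 := ℝ) c p
    · simpa [restrictSupport, hd, hc] using hasFDerivAt_const (0 : ℝ) p
  obtain ⟨⟨i₀, j₀⟩, h₀⟩ := hpos
  have h1 := hasFDerivAt_sumMulLog_escort (lam := lam) hlam (q := restrictSupport p) (q' := d)
    (x := p) (fun c => by
      by_cases hc : 0 < p c
      · exact Or.inl ⟨by rwa [hpp], hcell c⟩
      · exact Or.inr ⟨fun y => by simp [restrictSupport, hc], by simp [hd, hc]⟩)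
    ⟨(i₀, j₀), by rwa [hpp]⟩
  have h2 := hasFDerivAt_sumMulLog_escort (lam := lam) hlam
    (q := fun q => marginalX (restrictSupport p q)) (q' := fun i => ∑ j, d (i, j)) (x := p)
    (fun i => by
      by_cases hi : ∃ j, 0 < p (i, j)
      · refine Or.inl ⟨?_, HasFDerivAt.fun_sum fun j _ => hcell (i, j)⟩
        rw [hpp]
        obtain ⟨j, hj⟩ := hi
        exact Finset.sum_pos' (fun j _ => hp _) ⟨j, Finset.mem_univ _, hj⟩
      · push Not at hi
        exact Or.inr ⟨fun y => by simp [marginalX, restrictSupport, (hi _).not_gt],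
          by simp [hd, (hi _).not_gt]⟩)
    ⟨i₀, by
      simp only [hpp]
      exact Finset.sum_pos' (fun j _ => hp _) ⟨j₀, Finset.mem_univ _, h₀⟩⟩
  have h3 := hasFDerivAt_sumMulLog_escort (lam := lam) hlam
    (q := fun q => marginalY (restrictSupport p q)) (q' := fun j => ∑ i, d (i, j)) (x := p)
    (fun j => by
      by_cases hj : ∃ i, 0 < p (i, j)
      · refine Or.inl ⟨?_, HasFDerivAt.fun_sum fun i _ => hcell (i, j)⟩
        rw [hpp]
        obtain ⟨i, hi⟩ := hj
        exact Finset.sum_pos' (fun i _ => hp _) ⟨i, Finset.mem_univ _, hi⟩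
      · push Not at hj
        exact Or.inr ⟨fun y => by simp [marginalY, restrictSupport, (hj _).not_gt],
          by simp [hd, (hj _).not_gt]⟩)
    ⟨j₀, by
      simp only [hpp]
      exact Finset.sum_pos' (fun i _ => hp _) ⟨i₀, Finset.mem_univ _, h₀⟩⟩
  refine ((h1.sub h2).sub h3).congr_fderiv ?_
  -- The marginal contributions are regrouped as sums over cells: cell `(i, j)` collects one term
  -- from row `i` and one from column `j`.
  simp only [hpp, Finset.smul_sum]
  rw [Finset.sum_comm (γ := β), ← Fintype.sum_prod_type',
    ← Fintype.sum_prod_type' (f := fun i j => entropyGrad lam (marginalY p) j • d (i, j)),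
    ← Finset.sum_sub_distrib, ← Finset.sum_sub_distrib]
  refine Finset.sum_congr rfl fun c _ => ?_
  ext v
  by_cases hc : 0 < p c
  · simp [hd, cellGrad, hc, sub_mul]
  · simp [hd, cellGrad, hc]

/-! ### Escort density, escort mean of the logarithm, and the mode. -/

/-- The density of the escort distribution of `q` with respect to `q`. -/
def escortDensity {κ : Type*} [Fintype κ] (lam : ℝ) (q : κ → ℝ) (k : κ) : ℝ :=
  q k ^ (lam - 1) / ∑ s, q s ^ lam

/-- The mean of `ln q` under the escort distribution of `q`. -/
def escortMeanLog {κ : Type*} [Fintype κ] (lam : ℝ) (q : κ → ℝ) : ℝ :=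
  (∑ s, q s ^ lam * Real.log (q s)) / ∑ s, q s ^ lam

lemma entropyGrad_eq {κ : Type*} [Fintype κ] (lam : ℝ) (q : κ → ℝ) (k : κ) :
    entropyGrad lam q k =
      lam ^ 2 * escortDensity lam q k * (Real.log (q k) - escortMeanLog lam q) := rfl

lemma exists_pos_of_sum_eq_one {κ : Type*} [Fintype κ] {q : κ → ℝ} (h1 : ∑ k, q k = 1) :
    ∃ k, 0 < q k := by
  by_contra! h
  linarith [Finset.sum_nonpos fun k (_ : k ∈ Finset.univ) => h k]

lemma mul_escortDensity {κ : Type*} [Fintype κ] {lam : ℝ} (hlam : lam ≠ 0) {q : κ → ℝ}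
    (hq : ∀ k, 0 ≤ q k) (k : κ) :
    q k * escortDensity lam q k = q k ^ lam / ∑ s, q s ^ lam := by
  rcases (hq k).eq_or_lt with h0 | hk
  · rw [← h0, zero_mul, Real.zero_rpow hlam, zero_div]
  · rw [escortDensity, ← mul_div_assoc, Real.rpow_sub_one hk.ne', mul_div_cancel₀ _ hk.ne']

lemma sum_mul_escortDensity {κ : Type*} [Fintype κ] {lam : ℝ} (hlam : lam ≠ 0) {q : κ → ℝ}
    (hq : ∀ k, 0 ≤ q k) (h : ∃ k, 0 < q k) : ∑ k, q k * escortDensity lam q k = 1 := by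
  rw [Finset.sum_congr rfl fun k _ => mul_escortDensity hlam hq k, ← Finset.sum_div,
    div_self (sum_rpow_pos hq h).ne']

lemma sum_mul_escortDensity_mul_log {κ : Type*} [Fintype κ] {lam : ℝ} (hlam : lam ≠ 0)
    {q : κ → ℝ} (hq : ∀ k, 0 ≤ q k) (h : ∃ k, 0 < q k) :
    ∑ k, q k * escortDensity lam q k * (Real.log (q k) - escortMeanLog lam q) = 0 := by
  simp only [mul_sub]
  rw [Finset.sum_sub_distrib, ← Finset.sum_mul, sum_mul_escortDensity hlam hq h, one_mul,
    escortMeanLog, Finset.sum_div, sub_eq_zero]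
  refine Finset.sum_congr rfl fun k _ => ?_
  rw [mul_escortDensity hlam hq]
  ring

/-- The density is increasing in `q` for `lam > 1` and decreasing for `lam < 1`; the factor `lam -
1` treats both cases at once. -/
lemma sub_one_mul_escortDensity_lt {κ : Type*} [Fintype κ] {lam : ℝ} (hlam : lam ≠ 1) {q : κ → ℝ}
    (hq : ∀ k, 0 ≤ q k) {k i : κ} (hk : 0 < q k) (hki : q k < q i) :
    (lam - 1) * escortDensity lam q k < (lam - 1) * escortDensity lam q i := by
  have hS := sum_rpow_pos (lam := lam) hq ⟨k, hk⟩
  rcases hlam.lt_or_gt with hl | hl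
  · refine mul_lt_mul_of_neg_left ?_ (sub_neg.2 hl)
    exact div_lt_div_of_pos_right (Real.rpow_lt_rpow_of_neg hk hki (sub_neg.2 hl)) hS
  · refine mul_lt_mul_of_pos_left ?_ (sub_pos.2 hl)
    exact div_lt_div_of_pos_right (Real.rpow_lt_rpow hk.le hki (sub_pos.2 hl)) hS

/-- Take `i` maximising `q`. The escort average of `ln q` lies strictly below `ln (q i)` because
some letter of positive mass has smaller probability. Likewise `escortDensity` has `q`-mean one, so
by monotonicity its value at the mode lies strictly on the side of one given by the sign of `lam -
1`. -/
lemma exists_mode {κ : Type*} [Fintype κ] {lam : ℝ} (h0 : lam ≠ 0) (hlam : lam ≠ 1) {q : κ → ℝ}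
    (hq : ∀ k, 0 ≤ q k) (h1 : ∑ k, q k = 1) (hu : ¬ IsUniformOnSupport q) :
    ∃ i, 0 < q i ∧ 0 < escortDensity lam q i ∧ 0 < Real.log (q i) - escortMeanLog lam q ∧
      0 < (lam - 1) * (escortDensity lam q i - 1) := by
  have hpos := exists_pos_of_sum_eq_one h1
  have hne : Nonempty κ := ⟨hpos.choose⟩
  obtain ⟨i, hi⟩ := Finite.exists_max q
  obtain ⟨m, hm, hmi⟩ : ∃ m, 0 < q m ∧ q m < q i := by
    by_contra! h
    exact hu fun a b ha hb =>
      ((hi a).antisymm (h a ha)).trans ((hi b).antisymm (h b hb)).symm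
  have hqi := hm.trans hmi
  have hdens : ∀ k, 0 < q k → 0 < escortDensity lam q k := fun k hk =>
    div_pos (Real.rpow_pos_of_pos hk _) (sum_rpow_pos hq hpos)
  refine ⟨i, hqi, hdens i hqi, ?_, ?_⟩
  · have hsum : ∑ k, q k * escortDensity lam q k * (Real.log (q i) - Real.log (q k)) =
        Real.log (q i) - escortMeanLog lam q := by
      have := sum_mul_escortDensity_mul_log h0 hq hpos
      rw [← sub_zero (Real.log (q i) - _), ← this, ← one_mul (Real.log (q i) - _),
        ← sum_mul_escortDensity h0 hq hpos, Finset.sum_mul, ← Finset.sum_sub_distrib]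
      exact Finset.sum_congr rfl fun k _ => by ring
    rw [← hsum]
    refine Finset.sum_pos' (fun k _ => ?_) ⟨m, Finset.mem_univ _, ?_⟩
    · rcases (hq k).eq_or_lt with hk | hk
      · simp [← hk]
      · exact mul_nonneg (mul_pos hk (hdens k hk)).le
          (sub_nonneg.2 (Real.log_le_log hk (hi k)))
    · exact mul_pos (mul_pos hm (hdens m hm)) (sub_pos.2 (Real.log_lt_log hm hmi))
  · have hsum : ∑ k, q k * ((lam - 1) * escortDensity lam q i -
        (lam - 1) * escortDensity lam q k) = (lam - 1) * (escortDensity lam q i - 1) := by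
      simp only [mul_sub, Finset.sum_sub_distrib]
      rw [← Finset.sum_mul, h1, one_mul, mul_one]
      simp only [mul_left_comm _ (lam - 1)]
      rw [← Finset.mul_sum, sum_mul_escortDensity h0 hq hpos, mul_one]
    rw [← hsum]
    refine Finset.sum_pos' (fun k _ => ?_) ⟨m, Finset.mem_univ _, ?_⟩
    · rcases (hq k).eq_or_lt with hk | hk
      · simp [← hk]
      · refine mul_nonneg hk.le (sub_nonneg.2 ?_)
        rcases (hi k).eq_or_lt with hki | hki
        · simp [escortDensity, hki]
        · exact (sub_one_mul_escortDensity_lt hlam hq hk hki).le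
    · exact mul_pos hm (sub_pos.2 (sub_one_mul_escortDensity_lt hlam hq hm hmi))

/-! ### Product distributions: vanishing of `TA`, centring and non-degeneracy of its gradient. -/

section Product

lemma marginalX_prod {α β : Type*} [Fintype β] {a : α → ℝ} {b : β → ℝ}
    (hb1 : ∑ j, b j = 1) : marginalX (fun c : α × β => a c.1 * b c.2) = a := by
  ext i
  simp [marginalX, ← Finset.mul_sum, hb1]

lemma marginalY_prod {α β : Type*} [Fintype α] {a : α → ℝ} {b : β → ℝ}
    (ha1 : ∑ i, a i = 1) : marginalY (fun c : α × β => a c.1 * b c.2) = b := by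
  ext j
  simp [marginalY, ← Finset.sum_mul, ha1]

variable {α β : Type*} [Fintype α] [Fintype β] {lam : ℝ} {a : α → ℝ} {b : β → ℝ}

lemma sum_prod_rpow (ha : ∀ i, 0 ≤ a i) (hb : ∀ j, 0 ≤ b j) :
    ∑ c : α × β, (a c.1 * b c.2) ^ lam = (∑ i, a i ^ lam) * ∑ j, b j ^ lam := by
  rw [Fintype.sum_prod_type, Finset.sum_mul_sum]
  exact Finset.sum_congr rfl fun i _ => Finset.sum_congr rfl fun j _ =>
    Real.mul_rpow (ha i) (hb j)

lemma sum_prod_rpow_mul_log (hlam : lam ≠ 0) (ha : ∀ i, 0 ≤ a i) (hb : ∀ j, 0 ≤ b j) :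
    ∑ c : α × β, (a c.1 * b c.2) ^ lam * Real.log (a c.1 * b c.2) =
      (∑ i, a i ^ lam * Real.log (a i)) * (∑ j, b j ^ lam) +
        (∑ i, a i ^ lam) * ∑ j, b j ^ lam * Real.log (b j) := by
  rw [Fintype.sum_prod_type, Finset.sum_mul_sum, Finset.sum_mul_sum, ← Finset.sum_add_distrib]
  refine Finset.sum_congr rfl fun i _ => ?_
  rw [← Finset.sum_add_distrib]
  refine Finset.sum_congr rfl fun j _ => ?_
  rcases (ha i).eq_or_lt with hi | hi
  · simp [← hi, Real.zero_rpow hlam]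
  rcases (hb j).eq_or_lt with hj | hj
  · simp [← hj, Real.zero_rpow hlam]
  rw [Real.mul_rpow hi.le hj.le, Real.log_mul hi.ne' hj.ne']
  ring

lemma escortMeanLog_prod (hlam : lam ≠ 0) (ha : ∀ i, 0 ≤ a i) (hb : ∀ j, 0 ≤ b j)
    (hap : ∃ i, 0 < a i) (hbp : ∃ j, 0 < b j) :
    escortMeanLog lam (fun c : α × β => a c.1 * b c.2) =
      escortMeanLog lam a + escortMeanLog lam b := by
  have h1 := sum_rpow_pos (lam := lam) ha hap
  have h2 := sum_rpow_pos (lam := lam) hb hbp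
  simp only [escortMeanLog]
  rw [sum_prod_rpow_mul_log hlam ha hb, sum_prod_rpow ha hb]
  field_simp

lemma escortDensity_prod (ha : ∀ i, 0 ≤ a i) (hb : ∀ j, 0 ≤ b j) (c : α × β) :
    escortDensity lam (fun c : α × β => a c.1 * b c.2) c =
      escortDensity lam a c.1 * escortDensity lam b c.2 := by
  simp only [escortDensity]
  rw [sum_prod_rpow ha hb, Real.mul_rpow (ha _) (hb _), mul_div_mul_comm]

lemma TA_prod (hlam : lam ≠ 0) (ha : ∀ i, 0 ≤ a i) (hb : ∀ j, 0 ≤ b j)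
    (ha1 : ∑ i, a i = 1) (hb1 : ∑ j, b j = 1) :
    TA lam (fun c : α × β => a c.1 * b c.2) = 0 := by
  have hap := exists_pos_of_sum_eq_one ha1
  have hbp := exists_pos_of_sum_eq_one hb1
  have hm := escortMeanLog_prod hlam ha hb hap hbp
  have hp := sumMulLog_escort (q := fun c : α × β => a c.1 * b c.2) hlam
    (fun c => mul_nonneg (ha _) (hb _))
    ⟨(hap.choose, hbp.choose), mul_pos hap.choose_spec hbp.choose_spec⟩
  rw [TA, marginalX_prod hb1, marginalY_prod ha1, sumMulLog_escort hlam ha hap,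
    sumMulLog_escort hlam hb hbp, hp]
  simp only [escortMeanLog] at hm
  rw [hm, sum_prod_rpow ha hb,
    Real.log_mul (sum_rpow_pos ha hap).ne' (sum_rpow_pos hb hbp).ne']
  ring

lemma cellGrad_prod (hlam : lam ≠ 0) (ha : ∀ i, 0 ≤ a i) (hb : ∀ j, 0 ≤ b j)
    (ha1 : ∑ i, a i = 1) (hb1 : ∑ j, b j = 1) {i : α} {j : β} (hi : 0 < a i) (hj : 0 < b j) :
    cellGrad lam (fun c : α × β => a c.1 * b c.2) (i, j) =
      lam ^ 2 * (escortDensity lam a i * (Real.log (a i) - escortMeanLog lam a) *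
          (escortDensity lam b j - 1) +
        escortDensity lam b j * (Real.log (b j) - escortMeanLog lam b) *
          (escortDensity lam a i - 1)) := by
  rw [cellGrad, if_pos (mul_pos hi hj), marginalX_prod hb1, marginalY_prod ha1, entropyGrad_eq,
    entropyGrad_eq, entropyGrad_eq, escortMeanLog_prod hlam ha hb (exists_pos_of_sum_eq_one ha1)
      (exists_pos_of_sum_eq_one hb1), escortDensity_prod ha hb, Real.log_mul hi.ne' hj.ne']
  ring

/-- Each of the two summands of `cellGrad_prod` separates into a function of `i` times a function of
`j`, and one factor is the deviation of the logarithm from its escort mean, which sums to zero. -/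
lemma sum_mul_cellGrad_prod (hlam : lam ≠ 0) (ha : ∀ i, 0 ≤ a i) (hb : ∀ j, 0 ≤ b j)
    (ha1 : ∑ i, a i = 1) (hb1 : ∑ j, b j = 1) :
    ∑ c : α × β, a c.1 * b c.2 * cellGrad lam (fun c : α × β => a c.1 * b c.2) c = 0 := by
  have hap := exists_pos_of_sum_eq_one ha1
  have hbp := exists_pos_of_sum_eq_one hb1
  have hterm : ∀ i j, a i * b j * cellGrad lam (fun c : α × β => a c.1 * b c.2) (i, j) =
      (a i * escortDensity lam a i * (Real.log (a i) - escortMeanLog lam a)) *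
          (lam ^ 2 * (b j * escortDensity lam b j - b j)) +
        lam ^ 2 * (a i * escortDensity lam a i - a i) *
          (b j * escortDensity lam b j * (Real.log (b j) - escortMeanLog lam b)) := by
    intro i j
    rcases (ha i).eq_or_lt with hi | hi
    · simp [← hi]
    rcases (hb j).eq_or_lt with hj | hj
    · simp [← hj]
    rw [cellGrad_prod hlam ha hb ha1 hb1 hi hj]
    ring
  rw [Fintype.sum_prod_type]
  simp only [hterm, Finset.sum_add_distrib]
  rw [← Finset.sum_mul_sum, ← Finset.sum_mul_sum, sum_mul_escortDensity_mul_log hlam ha hap,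
    sum_mul_escortDensity_mul_log hlam hb hbp, zero_mul, mul_zero, add_zero]

/-- At a pair of modes, both summands of `cellGrad_prod` become positive after multiplication by
`lam - 1`, so they cannot cancel. -/
lemma exists_cellGrad_prod_ne_zero (h0 : lam ≠ 0) (hlam : lam ≠ 1) (ha : ∀ i, 0 ≤ a i)
    (hb : ∀ j, 0 ≤ b j) (ha1 : ∑ i, a i = 1) (hb1 : ∑ j, b j = 1)
    (hau : ¬ IsUniformOnSupport a) (hbu : ¬ IsUniformOnSupport b) :
    ∃ c : α × β, 0 < a c.1 * b c.2 ∧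
      cellGrad lam (fun c : α × β => a c.1 * b c.2) c ≠ 0 := by
  obtain ⟨i, hi, hdi, hxi, hui⟩ := exists_mode h0 hlam ha ha1 hau
  obtain ⟨j, hj, hdj, hxj, huj⟩ := exists_mode h0 hlam hb hb1 hbu
  refine ⟨(i, j), mul_pos hi hj, fun h => ?_⟩
  rw [cellGrad_prod h0 ha hb ha1 hb1 hi hj] at h
  have h1 := mul_pos (mul_pos hdi hxi) huj
  have h2 := mul_pos (mul_pos hdj hxj) hui
  have h3 := (mul_eq_zero.1 h).resolve_left (pow_ne_zero 2 h0)
  have h4 := congrArg ((lam - 1) * ·) h3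
  simp only [mul_zero] at h4
  linarith

end Product

/-! ### Free coordinates and the quadratic form of the multinomial covariance. -/

/-- Changing one free coordinate transfers mass between that cell and `r`, which is why the partial
derivatives are differences `g c - g r`. -/
lemma ofFree_update_freeCoord {κ : Type*} [Fintype κ] [DecidableEq κ] {r : κ} {p : κ → ℝ}
    (hp1 : ∑ c, p c = 1) (c : {c : κ // c ≠ r}) (t : ℝ) :
    ofFree r (Function.update (freeCoord r p) c t) =
      p + (t - p c) • (Pi.single (c : κ) 1 - Pi.single r 1) := by
  have hsum : ∑ d, Function.update (freeCoord r p) c t d = 1 - p r + (t - p c) := by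
    have hu : Function.update (freeCoord r p) c t =
        freeCoord r p + Pi.single c (t - p c) := by
      ext d
      rcases eq_or_ne d c with rfl | hd
      · simp [freeCoord]
      · simp [hd]
    have hr := Fintype.sum_eq_add_sum_subtype_ne p r
    rw [hp1] at hr
    have hf : ∑ d, freeCoord r p d = 1 - p r := by
      simp only [freeCoord]
      linarith
    simp [hu, Finset.sum_add_distrib, hf]
  ext d
  rw [ofFree]
  split_ifs with hd
  · subst hd
    rw [hsum]
    simp [c.2.symm]
    ring
  · rcases eq_or_ne d c with rfl | hdc
    · simp [hd]
    · have : (⟨d, hd⟩ : {c : κ // c ≠ r}) ≠ c := fun h => hdc (congrArg Subtype.val h)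
      simp [hd, hdc, this, freeCoord]

lemma dotProduct_multinomialCov_mulVec {κ : Type*} [Fintype κ] [DecidableEq κ] (v D : κ → ℝ) :
    D ⬝ᵥ (multinomialCov v *ᵥ D) = ∑ c, v c * D c ^ 2 - (∑ c, v c * D c) ^ 2 := by
  have hrow : ∀ c, (multinomialCov v *ᵥ D) c = v c * D c - v c * ∑ d, v d * D d := by
    intro c
    have : ∀ d, multinomialCov v c d * D d = (if c = d then v c * D d else 0)
        - v c * (v d * D d) := by
      intro d
      rw [multinomialCov, Matrix.of_apply]
      split_ifs with h
      · subst h; ring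
      · ring
    simp only [mulVec, dotProduct, this, Finset.sum_sub_distrib, ← Finset.mul_sum]
    simp
  simp only [dotProduct, hrow, mul_sub, Finset.sum_sub_distrib, pow_two, Finset.sum_mul]
  congr 1
  · exact Finset.sum_congr rfl fun c _ => by ring
  · exact Finset.sum_congr rfl fun c _ => by ring

/-- The form is the variance of `g - g r` under `p`: the reference cell contributes zero to both
moments, and subtracting the constant `g r` does not change the variance. Cells of mass zero carry
zero weight, so `D` matters only on the support. -/
lemma dotProduct_multinomialCov_freeCoord {κ : Type*} [Fintype κ] [DecidableEq κ] {r : κ}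
    {p g : κ → ℝ} (hp : ∀ c, 0 ≤ p c) (hp1 : ∑ c, p c = 1) {D : {c : κ // c ≠ r} → ℝ}
    (hD : ∀ c : {c : κ // c ≠ r}, 0 < p c → D c = g c - g r) :
    D ⬝ᵥ (multinomialCov (freeCoord r p) *ᵥ D) = ∑ c, p c * g c ^ 2 - (∑ c, p c * g c) ^ 2 := by
  have h1 : ∑ c, freeCoord r p c * D c = ∑ c, p c * g c - g r := by
    have hc : ∀ c : {c : κ // c ≠ r}, freeCoord r p c * D c = p c * (g c - g r) := by
      intro c
      rcases (hp c).eq_or_lt with h | h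
      · simp [freeCoord, ← h]
      · rw [hD c h, freeCoord]
    rw [Finset.sum_congr rfl fun c _ => hc c]
    have := Fintype.sum_eq_add_sum_subtype_ne (fun c => p c * (g c - g r)) r
    rw [sub_self, mul_zero, zero_add] at this
    rw [← this]
    simp only [mul_sub, Finset.sum_sub_distrib, ← Finset.sum_mul, hp1, one_mul]
  have h2 : ∑ c, freeCoord r p c * D c ^ 2 =
      ∑ c, p c * g c ^ 2 - 2 * g r * (∑ c, p c * g c) + g r ^ 2 := by
    have hc : ∀ c : {c : κ // c ≠ r}, freeCoord r p c * D c ^ 2 = p c * (g c - g r) ^ 2 := by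
      intro c
      rcases (hp c).eq_or_lt with h | h
      · simp [freeCoord, ← h]
      · rw [hD c h, freeCoord]
    rw [Finset.sum_congr rfl fun c _ => hc c]
    have := Fintype.sum_eq_add_sum_subtype_ne (fun c => p c * (g c - g r) ^ 2) r
    rw [sub_self, zero_pow two_ne_zero, mul_zero, zero_add] at this
    rw [← this]
    have hexp : ∀ c, p c * (g c - g r) ^ 2 =
        p c * g c ^ 2 - 2 * g r * (p c * g c) + p c * g r ^ 2 := fun c => by ring
    simp only [hexp, Finset.sum_add_distrib, Finset.sum_sub_distrib, ← Finset.mul_sum,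
      ← Finset.sum_mul, hp1, one_mul]
  rw [dotProduct_multinomialCov_mulVec, h1, h2]
  ring

section Gradient

variable {α β : Type*} [Fintype α] [Fintype β] [DecidableEq α] [DecidableEq β] {lam : ℝ}
  {p : α × β → ℝ} {r : α × β}

lemma hasDerivAt_TASection (hlam : lam ≠ 0) (hp : ∀ c, 0 ≤ p c) (hp1 : ∑ c, p c = 1)
    (hr : 0 < p r) (c : {c : α × β // c ≠ r}) (hc : 0 < p c) :
    HasDerivAt (TASection lam r p c) (cellGrad lam p c - cellGrad lam p r) (p c) := by
  -- Both cells that change mass lie in the support, so restricting to the support changes nothing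
  -- along this line.
  have hsec : TASection lam r p c = fun t => TA lam (restrictSupport p
      (p + (t - p c) • (Pi.single (c : α × β) 1 - Pi.single r 1))) := by
    ext t
    rw [TASection, ofFree_update_freeCoord hp1, restrictSupport_eq_self]
    intro d hd
    have h1 : d ≠ c := fun h => hd (h ▸ hc)
    have h2 : d ≠ r := fun h => hd (h ▸ hr)
    simp [h1, h2, le_antisymm (not_lt.1 hd) (hp d)]
  have hpath : HasDerivAt
      (fun t => p + (t - p c) • (Pi.single (c : α × β) 1 - Pi.single r 1 : α × β → ℝ))
      (Pi.single (c : α × β) 1 - Pi.single r 1) (p c) := by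
    simpa using (((hasDerivAt_id (p c)).sub_const (p c)).smul_const
      (Pi.single (c : α × β) 1 - Pi.single r 1 : α × β → ℝ)).const_add p
  have hG := hasFDerivAt_TA_restrictSupport hlam hp ⟨r, hr⟩
  rw [hsec]
  refine (HasFDerivAt.comp_hasDerivAt_of_eq (p c) hG hpath (by simp)).congr_deriv ?_
  simp [mul_sub, Finset.sum_sub_distrib, Pi.single_apply]

lemma asympVar_eq (hlam : lam ≠ 0) (hp : ∀ c, 0 ≤ p c) (hp1 : ∑ c, p c = 1) (hr : 0 < p r) :
    asympVar lam r p =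
      ∑ c, p c * cellGrad lam p c ^ 2 - (∑ c, p c * cellGrad lam p c) ^ 2 :=
  dotProduct_multinomialCov_freeCoord hp hp1 fun c hc =>
    (hasDerivAt_TASection hlam hp hp1 hr c hc).deriv

end Gradient

/-! ### The remainder in the delta method. -/

section DeltaMethod

variable {Ω E : Type*} [MeasurableSpace Ω] {P : Measure Ω} [IsProbabilityMeasure P]
  [NormedAddCommGroup E] [NormedSpace ℝ E]

/-- The remainder of the delta method vanishes in probability. -/
lemma tendstoInMeasure_sqrt_mul_remainder {W : ℕ → Ω → E} {p : E} {G : E → ℝ} {G' : E →L[ℝ] ℝ}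
    (hG : HasFDerivAt G G' p) {C : ℝ}
    (hW : ∀ n : ℕ, ∀ K : ℝ, 0 < K → P.real {ω | K ≤ √(n : ℝ) * ‖W n ω - p‖} ≤ C / K ^ 2) :
    TendstoInMeasure P
      (fun (n : ℕ) ω => √(n : ℝ) * (G (W n ω) - G p - G' (W n ω - p))) atTop 0 := by
  rw [tendstoInMeasure_iff_measureReal_norm]
  intro δ hδ
  rw [Metric.tendsto_atTop]
  intro η hη
  obtain ⟨K, hKη, hK⟩ : ∃ K : ℝ, C / K ^ 2 < η ∧ 0 < K := by
    have h : Tendsto (fun K : ℝ => C / K ^ 2) atTop (𝓝 0) :=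
      tendsto_const_nhds.div_atTop (tendsto_pow_atTop two_ne_zero)
    exact ((h.eventually (gt_mem_nhds hη)).and (eventually_gt_atTop 0)).exists
  -- Where `√n ‖W n - p‖ < K` and `W n` is near `p`, this slope bounds the scaled remainder by `δ /
  -- 2`. The complementary event has probability below `η` by the choice of `K`.
  have hε : 0 < δ / (2 * K) := by positivity
  obtain ⟨ρ, hρ, hball⟩ := Metric.eventually_nhds_iff.1
    ((hasFDerivAt_iff_isLittleO.1 hG).bound hε)
  obtain ⟨N, hN⟩ : ∃ N : ℕ, ∀ n ≥ N, K / ρ < √(n : ℝ) :=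
    eventually_atTop.1 ((Real.tendsto_sqrt_atTop.comp tendsto_natCast_atTop_atTop).eventually
      (eventually_gt_atTop (K / ρ)))
  refine ⟨N, fun n hn => ?_⟩
  rw [Real.dist_eq, sub_zero, abs_of_nonneg measureReal_nonneg]
  refine lt_of_le_of_lt (measureReal_mono fun ω hω => ?_) ((hW n K hK).trans_lt hKη)
  simp only [Set.mem_ofPred_eq, Pi.zero_apply, sub_zero, norm_mul, Real.norm_eq_abs,
    abs_of_nonneg (Real.sqrt_nonneg (n : ℝ))] at hω ⊢
  by_contra! hlt
  have hs : 0 < √(n : ℝ) := (div_pos hK hρ).trans (hN n hn)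
  have hnear : dist (W n ω) p < ρ := by
    rw [dist_eq_norm]
    have := (div_lt_iff₀ hρ).1 (hN n hn)
    exact lt_of_mul_lt_mul_left (hlt.trans this) hs.le
  have hb := mul_le_mul_of_nonneg_left (hball hnear) hs.le
  rw [Real.norm_eq_abs] at hb
  have : √(n : ℝ) * (δ / (2 * K) * ‖W n ω - p‖) < δ := by
    calc √(n : ℝ) * (δ / (2 * K) * ‖W n ω - p‖)
        = δ / (2 * K) * (√(n : ℝ) * ‖W n ω - p‖) := by ring
      _ ≤ δ / (2 * K) * K := by gcongr
      _ = δ / 2 := by field_simp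
      _ < δ := half_lt_self hδ
  linarith

end DeltaMethod

/-! ### Empirical distributions: tightness and the central limit theorem. -/

section Empirical

variable {κ Ω : Type*} [Fintype κ]

lemma sum_mul_empirical [DecidableEq κ] (Z : ℕ → Ω → κ) (f : κ → ℝ) (n : ℕ) (ω : Ω) :
    ∑ c, f c * empirical Z n ω c = (∑ k ∈ Finset.range n, f (Z k ω)) / n := by
  simp only [empirical, Finset.card_filter, Nat.cast_sum, Nat.cast_ite, Nat.cast_one,
    Nat.cast_zero, ← mul_div_assoc, ← Finset.sum_div, Finset.mul_sum]
  rw [Finset.sum_comm]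
  simp

variable [MeasurableSpace κ] [MeasurableSingletonClass κ] [MeasurableSpace Ω]

lemma aemeasurable_empirical [DecidableEq κ] {P : Measure Ω} {Z : ℕ → Ω → κ}
    (hZ : ∀ k, AEMeasurable (Z k) P) (n : ℕ) :
    AEMeasurable (fun ω => empirical Z n ω) P := by
  refine aemeasurable_pi_iff.2 fun c => ?_
  have h : (fun ω => empirical Z n ω c) =
      fun ω => (∑ k ∈ Finset.range n, if Z k ω = c then (1 : ℝ) else 0) / n := by
    ext ω
    simp [empirical]
  rw [h]
  refine AEMeasurable.div_const (Finset.aemeasurable_fun_sum _ fun k _ => ?_) _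
  exact (Measurable.of_discrete (f := fun z : κ => if z = c then (1 : ℝ) else 0)).comp_aemeasurable
    (hZ k)

variable {P : Measure Ω} [IsProbabilityMeasure P] {Z : ℕ → Ω → κ} {p : κ → ℝ}

lemma memLp_comp_of_finite {X : Ω → κ} (hX : AEMeasurable X P) (f : κ → ℝ) (s : ENNReal) :
    MemLp (fun ω => f (X ω)) s P :=
  MemLp.of_bound
    ((Measurable.of_discrete (f := f)).comp_aemeasurable hX).aestronglyMeasurable (∑ c, |f c|)
    (Eventually.of_forall fun ω => Finset.single_le_sum (f := fun c => |f c|)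
      (fun _ _ => abs_nonneg _) (Finset.mem_univ (X ω)))

lemma integral_comp_of_finite {X : Ω → κ} (hX : AEMeasurable X P)
    (hp : ∀ c, (P.map X).real {c} = p c) (f : κ → ℝ) :
    ∫ ω, f (X ω) ∂P = ∑ c, p c * f c := by
  have : IsProbabilityMeasure (P.map X) := Measure.isProbabilityMeasure_map hX
  rw [← integral_map (f := f) hX Measurable.of_discrete.aestronglyMeasurable,
    integral_fintype .of_finite]
  simp [hp]

variable [DecidableEq κ]

/-- Chebyshev's inequality in each cell, where the count has variance at most `n`, followed by a
union bound over the cells, the norm being the supremum norm. -/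
lemma measureReal_le_sqrt_mul_norm_empirical_sub (hZindep : iIndepFun Z P)
    (hZ : ∀ k, AEMeasurable (Z k) P) (hp : ∀ k c, (P.map (Z k)).real {c} = p c)
    (n : ℕ) {K : ℝ} (hK : 0 < K) :
    P.real {ω | K ≤ √(n : ℝ) * ‖empirical Z n ω - p‖} ≤ Fintype.card κ / K ^ 2 := by
  rcases n.eq_zero_or_pos with rfl | hn
  · simp only [Nat.cast_zero, Real.sqrt_zero, zero_mul, hK.not_ge, Set.ofPred_false,
      measureReal_empty]
    positivity
  have hn' : (0 : ℝ) < n := Nat.cast_pos.2 hn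
  have hs : 0 < √(n : ℝ) := Real.sqrt_pos.2 hn'
  have hsub : {ω | K ≤ √(n : ℝ) * ‖empirical Z n ω - p‖} ⊆
      ⋃ c, {ω | K ≤ √(n : ℝ) * |empirical Z n ω c - p c|} := by
    intro ω hω
    by_contra hnot
    simp only [Set.mem_iUnion, Set.mem_ofPred_eq, not_exists, not_le] at hnot hω
    have : ‖empirical Z n ω - p‖ < K / √(n : ℝ) :=
      (pi_norm_lt_iff (div_pos hK hs)).2 fun c => (lt_div_iff₀' hs).2 (hnot c)
    exact absurd ((lt_div_iff₀' hs).1 this) hω.not_gt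
  have hcell : ∀ c, P.real {ω | K ≤ √(n : ℝ) * |empirical Z n ω c - p c|} ≤ 1 / K ^ 2 := by
    intro c
    set f : κ → ℝ := fun z => if z = c then 1 else 0 with hf
    have hL : ∀ k, MemLp (fun ω => f (Z k ω)) 2 P := fun k => memLp_comp_of_finite (hZ k) f 2
    have hmean : ∀ k, ∫ ω, f (Z k ω) ∂P = p c := fun k => by
      rw [integral_comp_of_finite (hZ k) (hp k)]
      simp [hf]
    have hvar : ∀ k, Var[fun ω => f (Z k ω); P] ≤ 1 := fun k => by
      refine (variance_le_expectation_sq (hL k).1).trans ?_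
      have hsq : (fun ω => f (Z k ω)) ^ 2 = fun ω => f (Z k ω) := by
        ext ω
        by_cases h : Z k ω = c <;> simp [hf, h]
      rw [hsq, hmean, ← hp k c]
      have : IsProbabilityMeasure (P.map (Z k)) := Measure.isProbabilityMeasure_map (hZ k)
      exact measureReal_le_one
    have hmeanS : ∫ ω, (∑ k ∈ Finset.range n, fun ω => f (Z k ω)) ω ∂P = n * p c := by
      simp only [Finset.sum_apply]
      rw [integral_finsetSum _ fun k _ => (hL k).integrable one_le_two]
      simp [hmean]
    have hvarS : Var[∑ k ∈ Finset.range n, fun ω => f (Z k ω); P] ≤ n := by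
      rw [IndepFun.variance_sum (fun k _ => hL k) fun i _ j _ hij =>
        (hZindep.indepFun hij).comp (φ := f) (ψ := f) Measurable.of_discrete
          Measurable.of_discrete]
      simpa using Finset.sum_le_sum fun k (_ : k ∈ Finset.range n) => hvar k
    have hset : {ω | K ≤ √(n : ℝ) * |empirical Z n ω c - p c|} ⊆
        {ω | K * √(n : ℝ) ≤ |(∑ k ∈ Finset.range n, fun ω => f (Z k ω)) ω
          - ∫ ω, (∑ k ∈ Finset.range n, fun ω => f (Z k ω)) ω ∂P|} := by
      intro ω hω
      simp only [Set.mem_ofPred_eq] at hω ⊢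
      have he : empirical Z n ω c = (∑ k ∈ Finset.range n, f (Z k ω)) / n := by
        rw [← sum_mul_empirical]
        simp [hf]
      rw [hmeanS, Finset.sum_apply]
      have h1 : (∑ k ∈ Finset.range n, f (Z k ω)) - n * p c =
          n * (empirical Z n ω c - p c) := by
        rw [he]
        field_simp
      rw [h1, abs_mul, abs_of_pos hn']
      calc K * √(n : ℝ) ≤ (√(n : ℝ) * |empirical Z n ω c - p c|) * √(n : ℝ) := by gcongr
        _ = (√(n : ℝ) * √(n : ℝ)) * |empirical Z n ω c - p c| := by ring
        _ = n * |empirical Z n ω c - p c| := by rw [Real.mul_self_sqrt hn'.le]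
    refine (measureReal_mono hset).trans ?_
    have hch := meas_ge_le_variance_div_sq (memLp_finsetSum' (Finset.range n) fun k _ => hL k)
      (mul_pos hK hs)
    refine (ENNReal.toReal_le_of_le_ofReal (div_nonneg (variance_nonneg _ _) (sq_nonneg _))
      hch).trans ?_
    rw [mul_pow, Real.sq_sqrt hn'.le, div_le_div_iff₀ (by positivity) (by positivity)]
    nlinarith [sq_nonneg K]
  calc P.real {ω | K ≤ √(n : ℝ) * ‖empirical Z n ω - p‖}
      ≤ P.real (⋃ c, {ω | K ≤ √(n : ℝ) * |empirical Z n ω c - p c|}) := measureReal_mono hsub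
    _ ≤ ∑ c, P.real {ω | K ≤ √(n : ℝ) * |empirical Z n ω c - p c|} :=
        measureReal_iUnion_fintype_le _
    _ ≤ ∑ _c : κ, 1 / K ^ 2 := Finset.sum_le_sum fun c _ => hcell c
    _ = Fintype.card κ / K ^ 2 := by simp [div_eq_mul_inv]

/-- The delta method for a function of the empirical distribution. -/
lemma tendstoInDistribution_sqrt_mul_empirical (hZindep : iIndepFun Z P)
    (hZ : ∀ k, AEMeasurable (Z k) P) (hp : ∀ k c, (P.map (Z k)).real {c} = p c)
    {G : (κ → ℝ) → ℝ} (hGm : Measurable G) (hGp : G p = 0) {g : κ → ℝ}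
    (hG : HasFDerivAt G (∑ c, g c • ContinuousLinearMap.proj (R := ℝ) (φ := fun _ => ℝ) c) p)
    (hg : ∑ c, p c * g c = 0) :
    TendstoInDistribution (fun (n : ℕ) ω => √(n : ℝ) * G (empirical Z n ω)) atTop (id : ℝ → ℝ)
      (fun _ => P) (gaussianReal 0 (∑ c, p c * g c ^ 2).toNNReal) := by
  have hident : ∀ k, IdentDistrib (Z k) (Z 0) P P := fun k => ⟨hZ k, hZ 0, by
    have : ∀ k, IsProbabilityMeasure (P.map (Z k)) := fun k =>
      Measure.isProbabilityMeasure_map (hZ k)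
    refine Measure.ext_of_singleton fun c => ?_
    rw [← measureReal_eq_measureReal_iff, hp, hp]⟩
  have hmean : ∫ ω, g (Z 0 ω) ∂P = 0 := by rw [integral_comp_of_finite (hZ 0) (hp 0), hg]
  have hvar : Var[fun ω => g (Z 0 ω); P] = ∑ c, p c * g c ^ 2 := by
    rw [variance_of_integral_eq_zero (memLp_comp_of_finite (hZ 0) g 2).1.aemeasurable hmean,
      ← integral_comp_of_finite (hZ 0) (hp 0)]
  have hclt := tendstoInDistribution_inv_sqrt_mul_sum_sub (P := P)
    (P' := gaussianReal 0 (∑ c, p c * g c ^ 2).toNNReal) (X := fun k ω => g (Z k ω))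
    (Y := id) (by rw [hvar]; exact ⟨aemeasurable_id, Measure.map_id⟩)
    (memLp_comp_of_finite (hZ 0) g 2) (hZindep.comp (fun _ => g) fun _ => .of_discrete)
    (fun k => (hident k).comp (u := g) .of_discrete)
  -- Slutsky's theorem: the difference from the normalised sum is the delta-method remainder,
  -- because `hg` removes the centring term.
  refine tendstoInDistribution_of_tendstoInMeasure_sub _ _ hclt ?_ fun n => ?_
  · refine (tendstoInMeasure_sqrt_mul_remainder hG fun n K hK =>
      measureReal_le_sqrt_mul_norm_empirical_sub hZindep hZ hp n hK).congr_left fun n => ?_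
    refine Eventually.of_forall fun ω => ?_
    have hlin : (∑ c, g c • ContinuousLinearMap.proj (R := ℝ) (φ := fun _ => ℝ) c)
        (empirical Z n ω - p) = (∑ k ∈ Finset.range n, g (Z k ω)) / n := by
      rw [← sum_mul_empirical]
      simp only [_root_.sum_apply, _root_.smul_apply, ContinuousLinearMap.proj_apply,
        Pi.sub_apply, smul_eq_mul, mul_sub, Finset.sum_sub_distrib]
      simp only [mul_comm (g _) (p _), hg, sub_zero]
    simp only [Pi.sub_apply, hlin, hGp, sub_zero, hmean, mul_zero, mul_sub]
    congr 1
    rw [mul_div_left_comm, Real.sqrt_div_self', one_div, mul_comm]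
  · exact (hGm.comp_aemeasurable (aemeasurable_empirical hZ n)).const_mul _

end Empirical

/-! ### Measurability, and the laws of the pair and its marginals. -/

lemma measurable_sumMulLog_escort {κ E : Type*} [Fintype κ] [MeasurableSpace E] (lam : ℝ)
    {q : E → κ → ℝ} (hq : ∀ k, Measurable fun y => q y k) :
    Measurable fun y => sumMulLog (escort lam (q y)) := by
  unfold sumMulLog escort
  fun_prop

lemma measurable_TA_restrictSupport {α β : Type*} [Fintype α] [Fintype β] (lam : ℝ)
    (p : α × β → ℝ) : Measurable fun q => TA lam (restrictSupport p q) := by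
  have h : ∀ c, Measurable fun q => restrictSupport p q c := by
    intro c
    unfold restrictSupport
    split_ifs <;> fun_prop
  refine ((measurable_sumMulLog_escort lam h).sub (measurable_sumMulLog_escort lam ?_)).sub
    (measurable_sumMulLog_escort lam ?_)
  · unfold marginalX; fun_prop
  · unfold marginalY; fun_prop

lemma empirical_eq_zero {κ Ω : Type*} [DecidableEq κ] {Z : ℕ → Ω → κ} {ω : Ω} {c : κ}
    (h : ∀ k, Z k ω ≠ c) (n : ℕ) : empirical Z n ω c = 0 := by
  simp [empirical, h]

lemma sum_measureReal_eq_one {κ Ω : Type*} [Fintype κ] [MeasurableSpace κ]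
    [MeasurableSingletonClass κ] [MeasurableSpace Ω] {P : Measure Ω} [IsProbabilityMeasure P]
    {X : Ω → κ} (hX : Measurable X) : ∑ k, P.real {ω | X ω = k} = 1 := by
  have := sum_measureReal_preimage_singleton (μ := P) Finset.univ (f := X)
    fun k _ => hX (measurableSet_singleton k)
  simpa [Set.preimage] using this

lemma jointProb_eq_mul {α β Ω : Type*} [MeasurableSpace α] [MeasurableSpace β]
    [MeasurableSingletonClass α] [MeasurableSingletonClass β] [MeasurableSpace Ω] {P : Measure Ω}
    {X : Ω → α} {Y : Ω → β} (hXY : IndepFun X Y P) (c : α × β) :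
    jointProb P X Y c = P.real {ω | X ω = c.1} * P.real {ω | Y ω = c.2} := by
  have := hXY.measure_inter_preimage_eq_mul {c.1} {c.2} (measurableSet_singleton _)
    (measurableSet_singleton _)
  simp only [jointProb, measureReal_def, ← ENNReal.toReal_mul]
  exact congrArg ENNReal.toReal this

end EscortMI

end

theorem proposition1
    {α β : Type*} [Fintype α] [Fintype β] [DecidableEq α] [DecidableEq β]
    [MeasurableSpace α] [MeasurableSpace β]
    [MeasurableSingletonClass α] [MeasurableSingletonClass β]
    {Ω Ω' : Type*} [MeasurableSpace Ω] [MeasurableSpace Ω']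
    (P : Measure Ω) [IsProbabilityMeasure P] (P' : Measure Ω') [IsProbabilityMeasure P']
    (X : Ω → α) (Y : Ω → β) (hX : Measurable X) (hY : Measurable Y)
    -- the null hypothesis
    (hXY : IndepFun X Y P)
    -- neither marginal distribution is uniform on its support
    (hunifX : ¬ EscortMI.IsUniformOnSupport (EscortMI.marginalX (EscortMI.jointProb P X Y)))
    (hunifY : ¬ EscortMI.IsUniformOnSupport (EscortMI.marginalY (EscortMI.jointProb P X Y)))
    -- an iid sample from the distribution of the pair
    (Z : ℕ → Ω' → α × β) (hZindep : iIndepFun Z P')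
    (hZ : ∀ k, IdentDistrib (Z k) (fun ω => (X ω, Y ω)) P' P)
    (lam : ℝ) (hlam : lam ∈ Set.Ioo (0 : ℝ) 1 ∪ Set.Ioi (1 : ℝ))
    -- the reference cell, whose probability is one minus the sum of the others
    (r : α × β) (hr : 0 < EscortMI.jointProb P X Y r) :
    (∀ c : {c : α × β // c ≠ r}, 0 < EscortMI.jointProb P X Y c →
      DifferentiableAt ℝ (EscortMI.TASection lam r (EscortMI.jointProb P X Y) c)
        (EscortMI.jointProb P X Y c)) ∧
    0 < EscortMI.asympVar lam r (EscortMI.jointProb P X Y) ∧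
    TendstoInDistribution
      (fun (n : ℕ) (ω : Ω') => √(n : ℝ) * EscortMI.TA lam (EscortMI.empirical Z n ω))
      atTop (id : ℝ → ℝ) (fun _ => P')
      (gaussianReal 0 (EscortMI.asympVar lam r (EscortMI.jointProb P X Y)).toNNReal) := by
  have h0 : lam ≠ 0 := by
    rcases hlam with h | h
    · exact h.1.ne'
    · exact (zero_lt_one.trans h).ne'
  have h1 : lam ≠ 1 := by
    rcases hlam with h | h
    · exact h.2.ne
    · exact ne_of_gt h
  set a : α → ℝ := fun i => P.real {ω | X ω = i}
  set b : β → ℝ := fun j => P.real {ω | Y ω = j}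
  have hprod : EscortMI.jointProb P X Y = fun c => a c.1 * b c.2 :=
    funext (EscortMI.jointProb_eq_mul hXY)
  have ha : ∀ i, 0 ≤ a i := fun i => measureReal_nonneg
  have hb : ∀ j, 0 ≤ b j := fun j => measureReal_nonneg
  have ha1 : ∑ i, a i = 1 := EscortMI.sum_measureReal_eq_one hX
  have hb1 : ∑ j, b j = 1 := EscortMI.sum_measureReal_eq_one hY
  have hlaw : ∀ k c, (P'.map (Z k)).real {c} = EscortMI.jointProb P X Y c := by
    intro k c
    rw [(hZ k).map_eq, map_measureReal_apply (hX.prodMk hY) (measurableSet_singleton c)]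
    simp only [EscortMI.jointProb, Set.preimage, Set.mem_singleton_iff, Prod.ext_iff]
  rw [hprod] at hunifX hunifY hlaw hr ⊢
  rw [EscortMI.marginalX_prod hb1] at hunifX
  rw [EscortMI.marginalY_prod ha1] at hunifY
  set p : α × β → ℝ := fun c => a c.1 * b c.2 with hp_def
  have hp : ∀ c, 0 ≤ p c := fun c => mul_nonneg (ha _) (hb _)
  have hp1 : ∑ c, p c = 1 := by
    rw [hp_def, Fintype.sum_prod_type, ← Finset.sum_mul_sum, ha1, hb1, one_mul]
  have hcentred : ∑ c, p c * EscortMI.cellGrad lam p c = 0 :=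
    EscortMI.sum_mul_cellGrad_prod h0 ha hb ha1 hb1
  have hvar : EscortMI.asympVar lam r p = ∑ c, p c * EscortMI.cellGrad lam p c ^ 2 := by
    rw [EscortMI.asympVar_eq h0 hp hp1 hr, hcentred]
    ring
  refine ⟨fun c hc => (EscortMI.hasDerivAt_TASection h0 hp hp1 hr c hc).differentiableAt, ?_, ?_⟩
  · obtain ⟨c, hc, hgc⟩ := EscortMI.exists_cellGrad_prod_ne_zero h0 h1 ha hb ha1 hb1 hunifX hunifY
    rw [hvar]
    exact Finset.sum_pos' (fun c _ => mul_nonneg (hp c) (sq_nonneg _))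
      ⟨c, Finset.mem_univ _, mul_pos hc (pow_pos (abs_pos.2 hgc) 2 |>.trans_eq (sq_abs _))⟩
  · have hmeas : ∀ k, AEMeasurable (Z k) P' := fun k => (hZ k).aemeasurable_fst
    have hpp : EscortMI.restrictSupport p p = p :=
      EscortMI.restrictSupport_eq_self fun c hc => le_antisymm (not_lt.1 hc) (hp c)
    have hlim := EscortMI.tendstoInDistribution_sqrt_mul_empirical hZindep hmeas hlaw
      (EscortMI.measurable_TA_restrictSupport lam p)
      (by rw [hpp]; exact EscortMI.TA_prod h0 ha hb ha1 hb1)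
      (EscortMI.hasFDerivAt_TA_restrictSupport h0 hp ⟨r, hr⟩) hcentred
    rw [hvar]
    -- Almost surely no observation falls in a null cell, so the empirical distribution equals its
    -- restriction to the support and the limit carries over to the true plug-in estimator.
    have hsupp : ∀ᵐ ω ∂P', ∀ k c, ¬ 0 < p c → Z k ω ≠ c := by
      refine ae_all_iff.2 fun k => ae_all_iff.2 fun c => ?_
      by_cases hc : 0 < p c
      · simp [hc]
      have hnull : (P'.map (Z k)).real {c} = 0 := by
        rw [hlaw]
        exact le_antisymm (not_lt.1 hc) (hp c)
      have : IsProbabilityMeasure (P'.map (Z k)) := Measure.isProbabilityMeasure_map (hmeas k)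
      have hz := (measureReal_eq_zero_iff).1 hnull
      rw [Measure.map_apply_of_aemeasurable (hmeas k) (measurableSet_singleton c)] at hz
      filter_upwards [measure_eq_zero_iff_ae_notMem.1 hz] with ω hω _ h
      exact hω h
    refine hlim.congr (fun n => ?_) EventuallyEq.rfl
    filter_upwards [hsupp] with ω hω
    rw [EscortMI.restrictSupport_eq_self fun c hc =>
      EscortMI.empirical_eq_zero (fun k => hω k c hc) n]
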